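/- Let $\mathcal H$ be a real Hilbert space, $N\ge 1$, and let $\mathcal H^N$ carry the norm $\|\mathbf x\|^2=\sum_{i=1}^N\|x_i\|^2$. Let $\beta>0$ and let $H\colon\mathcal H^N\to\mathbb R$ be convex and differentiable with $\beta^{-1}$-Lipschitz gradient. Let $\mathcal Q_1,\dots,\mathcal Q_N\subset\mathcal H$ be nonempty, closed and convex, put $\overline{\mathcal Q}=\mathcal Q_1\times\cdots\times\mathcal Q_N$, let $V\subset\mathcal H^N$ be a closed vector subspace, and let $\xi_1,\dots,\xi_N\in\mathcal H$. Consider the problem $$\min_{\mathbf x\in\mathcal H^N}\Big\{H(\mathbf x)+\max_{1\le i\le N}\|x_i-\xi_i\|^2\Big\}\quad\text{s.t.}\quad \mathbf x\in V\cap\overline{\mathcal Q}.\tag{P}$$ With $f(\mathbf x)=\max_{1\le i\le N}\|x_i-\xi_i\|^2$, assume that the optimality inclusion $0\in\partial f(\mathbf x)+N_{\overline{\mathcal Q}}(\mathbf x)+\nabla H(\mathbf x)+N_V(\mathbf x)$ has at least one solution $\mathbf x\in\mathcal H^N$ (here $\partial$ is the convex subdifferential and $N_C(\mathbf x)$ the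 normal cone, which is empty if $\mathbf x\notin C$). For $\alpha\in\mathbb R_+^N$ and $\lambda>0$ let $\varphi(\alpha,\lambda)$ be the set of maximizers of $\sum_{i=1}^N\frac{p_i}{1+2\lambda p_i}\alpha_i$ over the simplex $\Delta_N=\{p\in\mathbb R_+^N:\sum_{i=1}^N p_i=1\}$. Let $\lambda\in\left]0,2\beta\right[$ and $0<\gamma<\frac1\lambda-\frac1{2\beta}$. Let $\mathbf u^0\in\mathcal H^N$, $\mathbf x^0\in V$, $\overline{\mathbf x}^0=\mathbf x^0$, $\mathbf y^0\in V^\perp$, and let, for every $k\in\mathbb N$, $$\begin{aligned} u_i^{k+1}&=u_i^k+\gamma\overline x_i^k-\gamma\operatorname{proj}_{\mathcal Q_i}\big(u_i^k/\gamma+\overline x_i^k\big)\quad(1\le i\le N),\\ \overline{\mathbf z}^k&=\mathbf x^k+\lambda\mathbf y^k-\lambda\operatorname{proj}_V\big(\mathbf u^{k+1}+\nabla H(\mathbf x^k)\big),\\ p^k&\in\varphi\big((\|\overline z_i^k-\xi_i\|^2)_{i=1}^N,\lambda\big),\\ w_i^{k+1}&=\frac{1}{1+2\lambda p_i^k}\big(\overline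 z_i^k+2\lambda p_i^k\xi_i\big)\quad(1\le i\le N),\\ \mathbf x^{k+1}&=\operatorname{proj}_V\mathbf w^{k+1},\\ \mathbf y^{k+1}&=\mathbf y^k+(\mathbf x^{k+1}-\mathbf w^{k+1})/\lambda,\\ \overline{\mathbf x}^{k+1}&=2\mathbf x^{k+1}-\mathbf x^k. \end{aligned}$$ Then there exists a solution $\mathbf x\in\mathcal H^N$ of (P) such that $\mathbf x^k\rightharpoonup\mathbf x$ weakly in $\mathcal H^N$. -/

import Mathlib

open Filter Topology

/-- The Hilbert product `E ^ N`, with norm `‖x‖ ^ 2 = ∑ i, ‖x i‖ ^ 2`. -/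
abbrev HilbertPow (N : ℕ) (E : Type*) : Type _ := PiLp 2 (fun _ : Fin N => E)

section General

variable {F : Type*} [NormedAddCommGroup F] [InnerProductSpace ℝ F]

/-- The projection `proj_C x = argmin_{y ∈ C} ‖x - y‖`. It is an arbitrary minimizer if there are
several, and arbitrary if there is none; for a nonempty closed convex set of a Hilbert space it is
the unique minimizer, see `metricProj_spec` and `metricProj_unique`. -/
noncomputable def metricProj (C : Set F) (x : F) : F :=
  Classical.epsilon fun y : F => y ∈ C ∧ ∀ z ∈ C, ‖x - y‖ ≤ ‖x - z‖

theorem metricProj_spec [CompleteSpace F] {C : Set F} (hne : C.Nonempty) (hcl : IsClosed C)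
    (hco : Convex ℝ C) (x : F) :
    metricProj C x ∈ C ∧ ∀ z ∈ C, ‖x - metricProj C x‖ ≤ ‖x - z‖ := by
  refine Classical.epsilon_spec (p := fun y : F => y ∈ C ∧ ∀ z ∈ C, ‖x - y‖ ≤ ‖x - z‖) ?_
  obtain ⟨y, hy, hmin⟩ := exists_norm_eq_iInf_of_complete_convex hne hcl.isComplete hco x
  refine ⟨y, hy, fun z hz => ?_⟩
  rw [hmin]
  exact ciInf_le ⟨0, by rintro _ ⟨w, rfl⟩; exact norm_nonneg _⟩ (⟨z, hz⟩ : C)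

theorem metricProj_unique [CompleteSpace F] {C : Set F} (hne : C.Nonempty) (hcl : IsClosed C)
    (hco : Convex ℝ C) (x y : F) (hy : y ∈ C) (hmin : ∀ z ∈ C, ‖x - y‖ ≤ ‖x - z‖) :
    metricProj C x = y := by
  have key : ∀ w ∈ C, (∀ z ∈ C, ‖x - w‖ ≤ ‖x - z‖) → ∀ z ∈ C, inner ℝ (x - w) (z - w) ≤ 0 := by
    intro w hw hm
    refine (norm_eq_iInf_iff_real_inner_le_zero hco hw).1 (le_antisymm ?_ ?_)
    · have : Nonempty C := ⟨⟨w, hw⟩⟩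
      exact le_ciInf fun z => hm z z.2
    · exact ciInf_le ⟨0, by rintro _ ⟨w, rfl⟩; exact norm_nonneg _⟩ (⟨w, hw⟩ : C)
  obtain ⟨hp, hpm⟩ := metricProj_spec hne hcl hco x
  set p := metricProj C x
  have h1 := key p hp hpm y hy
  have h2 := key y hy hmin p hp
  have h3 : inner ℝ (y - p) (y - p) ≤ (0 : ℝ) := by
    have e : inner ℝ (y - p) (y - p) = inner ℝ (x - p) (y - p) + inner ℝ (x - y) (p - y) := by
      have e1 : p - y = -(y - p) := by abel
      rw [e1, inner_neg_right, ← sub_eq_add_neg, ← inner_sub_left]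
      congr 1
      abel
    linarith
  rw [real_inner_self_eq_norm_sq] at h3
  have h4 : y - p = 0 := norm_eq_zero.1 (pow_eq_zero_iff two_ne_zero |>.1
    (le_antisymm h3 (sq_nonneg _)))
  exact (sub_eq_zero.1 h4).symm

/-- The convex subdifferential `∂f(x)` of a real-valued function. -/
def convexSubdifferential (f : F → ℝ) (x : F) : Set F :=
  {g | ∀ y, f x + inner ℝ g (y - x) ≤ f y}

/-- The normal cone `N_C(x)`, which is empty if `x ∉ C`. -/
def convexNormalCone (C : Set F) (x : F) : Set F :=
  {v | x ∈ C ∧ ∀ y ∈ C, inner ℝ v (y - x) ≤ 0}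

/-- Weak convergence `x k ⇀ a`. -/
def TendstoWeakly (x : ℕ → F) (a : F) : Prop :=
  Tendsto (fun k => toWeakSpace ℝ F (x k)) atTop (𝓝 (toWeakSpace ℝ F a))

end General

/-- `φ(α, lam)`: the set of maximizers of `∑ i, p i / (1 + 2 * lam * p i) * α i` over the
probability simplex. -/
def simplexArgmax {N : ℕ} (α : Fin N → ℝ) (lam : ℝ) : Set (Fin N → ℝ) :=
  {p | p ∈ stdSimplex ℝ (Fin N) ∧
    IsMaxOn (fun q : Fin N → ℝ => ∑ i, q i / (1 + 2 * lam * q i) * α i) (stdSimplex ℝ (Fin N)) p}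

section Problem

variable {N : ℕ} {E : Type*} [NormedAddCommGroup E] [InnerProductSpace ℝ E]

/-- The function `x ↦ max_{1 ≤ i ≤ N} ‖x i - ξ i‖ ^ 2` (used for `N ≥ 1`). -/
noncomputable def maxSqDist (ξ : Fin N → E) (x : HilbertPow N E) : ℝ :=
  ⨆ i, ‖x i - ξ i‖ ^ 2

/-- The product set `Q 1 × ⋯ × Q N`. -/
def prodSet (Q : Fin N → Set E) : Set (HilbertPow N E) :=
  {x | ∀ i, x i ∈ Q i}

/-- `x` solves: minimize `H x + max_i ‖x i - ξ i‖ ^ 2` subject to `x ∈ V ∩ (Q 1 × ⋯ × Q N)`. -/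
def IsQuadMaxSolution (H : HilbertPow N E → ℝ) (V : Submodule ℝ (HilbertPow N E))
    (Q : Fin N → Set E) (ξ : Fin N → E) (x : HilbertPow N E) : Prop :=
  x ∈ (V : Set (HilbertPow N E)) ∩ prodSet Q ∧
    IsMinOn (fun z => H z + maxSqDist ξ z) ((V : Set (HilbertPow N E)) ∩ prodSet Q) x

/-- The optimality inclusion `0 ∈ ∂f(x) + N_Q(x) + ∇H(x) + N_V(x)`, where
`f x = max_i ‖x i - ξ i‖ ^ 2` and `Q` is the product set. -/
def OptimalityInclusion [CompleteSpace E] (H : HilbertPow N E → ℝ)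
    (V : Submodule ℝ (HilbertPow N E)) (Q : Fin N → Set E) (ξ : Fin N → E)
    (x : HilbertPow N E) : Prop :=
  ∃ g ∈ convexSubdifferential (maxSqDist ξ) x, ∃ u ∈ convexNormalCone (prodSet Q) x,
    ∃ v ∈ convexNormalCone (V : Set (HilbertPow N E)) x, g + u + gradient H x + v = 0

/-- The recursion of the primal-dual routine: `u, x, xbar, y, zbar, w, p` are sequences generated
by it, with step sizes `lam` and `γ`. -/
structure IsPrimalDualRoutine [CompleteSpace E] (H : HilbertPow N E → ℝ)
    (V : Submodule ℝ (HilbertPow N E)) (Q : Fin N → Set E) (ξ : Fin N → E) (lam γ : ℝ)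
    (u x xbar y zbar w : ℕ → HilbertPow N E) (p : ℕ → Fin N → ℝ) : Prop where
  u_step : ∀ k i, u (k + 1) i =
    u k i + γ • xbar k i - γ • metricProj (Q i) (γ⁻¹ • u k i + xbar k i)
  z_step : ∀ k, zbar k =
    x k + lam • y k - lam • metricProj (V : Set (HilbertPow N E)) (u (k + 1) + gradient H (x k))
  p_step : ∀ k, p k ∈ simplexArgmax (fun i => ‖zbar k i - ξ i‖ ^ 2) lam
  w_step : ∀ k i, w (k + 1) i =
    (1 / (1 + 2 * lam * p k i)) • (zbar k i + (2 * lam * p k i) • ξ i)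
  x_step : ∀ k, x (k + 1) = metricProj (V : Set (HilbertPow N E)) (w (k + 1))
  y_step : ∀ k, y (k + 1) = y k + lam⁻¹ • (x (k + 1) - w (k + 1))
  xbar_step : ∀ k, xbar (k + 1) = (2 : ℝ) • x (k + 1) - x k

end Problem

/-! The algorithm is a primal-dual splitting written out for a maximum of squared distances. Two
facts bring it to an abstract form. The weights `p k` turn `w (k + 1)` into the proximal point of
`lam • maxSqDist ξ` at `zbar k`: stationarity over the simplex forces `p k` to charge only indices
where `‖w i - ξ i‖` is largest (`le_sum_of_mem_simplexArgmax`). Each metric projection is a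
normal-cone inclusion. This gives `IsPrimalDualSequence`.

For every solution of the optimality system, monotonicity of the subdifferential and of the normal
cone, together with cocoercivity of the gradient, makes `primalDualEnergy` decrease by a multiple of
the squared increments (`primalDualEnergy_step`). The bound on `γ` leaves exactly the slack needed
to absorb the cross terms. Hence the iterates are bounded, their increments vanish, and the
gradients converge strongly.

Weak cluster points solve the system: when the inclusions are summed, the only product of two weakly
convergent sequences cancels (`isPrimalDualSolution_of_tendsto`). An Opial-type argument with the
energies of two cluster points then shows that there is only one, and its primal part solves the
problem by convexity. -/

/-! ### Smooth convex functions, projections and weak limits in a Hilbert space. -/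

section GeneralLemmas

variable {F : Type*} [NormedAddCommGroup F] [InnerProductSpace ℝ F]

theorem nonpos_of_hasDerivAt_of_le {φ : ℝ → ℝ} {D : ℝ} (hφ : HasDerivAt φ D 0)
    (hmax : ∀ t, 0 < t → t ≤ 1 → φ t ≤ φ 0) : D ≤ 0 := by
  refine le_of_tendsto hφ.tendsto_slope_zero_right ?_
  filter_upwards [Ioc_mem_nhdsGT (zero_lt_one' ℝ)] with t ht
  have := hmax t ht.1 ht.2
  rw [zero_add, smul_eq_mul]
  exact mul_nonpos_of_nonneg_of_nonpos (inv_nonneg.2 ht.1.le) (by linarith)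

section Gradient

variable [CompleteSpace F]

theorem hasDerivAt_comp_line {H : F → ℝ} (hH : Differentiable ℝ H) (x d : F) (t : ℝ) :
    HasDerivAt (fun s : ℝ => H (x + s • d)) (inner ℝ (gradient H (x + t • d)) d) t := by
  have h1 : HasDerivAt (fun s : ℝ => x + s • d) d t := by
    simpa using ((hasDerivAt_id t).smul_const d).const_add x
  have h2 := (hH (x + t • d)).hasGradientAt.hasFDerivAt.comp_hasDerivAt t h1
  simpa [Function.comp_def] using h2

theorem add_inner_gradient_le {H : F → ℝ} (hconv : ConvexOn ℝ Set.univ H)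
    (hH : Differentiable ℝ H) (x y : F) : H x + inner ℝ (gradient H x) (y - x) ≤ H y := by
  have h := (((hasDerivAt_comp_line hH x (y - x) 0).sub
    ((hasDerivAt_id (0 : ℝ)).mul_const (H y - H x))))
  simp only [zero_smul, add_zero, one_mul] at h
  have := nonpos_of_hasDerivAt_of_le h ?_
  · linarith
  · intro t ht0 ht1
    have := hconv.2 (Set.mem_univ x) (Set.mem_univ y) (sub_nonneg.2 ht1) ht0.le (by ring)
    have e : (1 - t) • x + t • y = x + t • (y - x) := by module
    rw [e] at this
    simp only [smul_eq_mul] at this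
    simp only [Pi.sub_apply, id_eq, zero_smul, add_zero, zero_mul, sub_zero]
    linarith

/-- Descent lemma: along the ray, the gap between the two sides is monotone, because the Lipschitz
bound controls its derivative. -/
theorem le_add_inner_gradient_add_sq {H : F → ℝ} (hH : Differentiable ℝ H) {L : NNReal}
    (hlip : LipschitzWith L (gradient H)) (x d : F) :
    H (x + d) ≤ H x + inner ℝ (gradient H x) d + L / 2 * ‖d‖ ^ 2 := by
  have hd : ∀ t : ℝ, HasDerivAt (fun s : ℝ => H (x + s • d) - s * inner ℝ (gradient H x) d
      - s ^ 2 * (L / 2 * ‖d‖ ^ 2))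
      (inner ℝ (gradient H (x + t • d)) d - inner ℝ (gradient H x) d - t * (L * ‖d‖ ^ 2)) t := by
    intro t
    have := ((hasDerivAt_comp_line hH x d t).sub
      ((hasDerivAt_id t).mul_const (inner ℝ (gradient H x) d))).sub
      ((hasDerivAt_pow 2 t).mul_const (L / 2 * ‖d‖ ^ 2))
    refine this.congr_deriv ?_
    simp only [Nat.cast_ofNat]
    ring
  have hanti := antitoneOn_of_deriv_nonpos (convex_Ici (0 : ℝ))
    (fun t _ => (hd t).continuousAt.continuousWithinAt)
    (fun t _ => (hd t).differentiableAt.differentiableWithinAt) (fun t ht => by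
      rw [(hd t).deriv]
      have ht0 : 0 ≤ t := by
        rw [interior_Ici] at ht
        exact ht.le
      have h1 := real_inner_le_norm (gradient H (x + t • d) - gradient H x) d
      have h2 := hlip.norm_sub_le (x + t • d) x
      rw [add_sub_cancel_left, norm_smul, Real.norm_of_nonneg ht0] at h2
      rw [inner_sub_left] at h1
      nlinarith [mul_le_mul_of_nonneg_right h2 (norm_nonneg d)])
  have := hanti (Set.self_mem_Ici) (Set.mem_Ici.2 (zero_le_one' ℝ)) zero_le_one
  simp only [one_smul, zero_smul, add_zero] at this
  linarith

/-- Baillon–Haddad. Compare `H` with its tangent at `y` at the point reached from `x` by a step of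
length `β` against the gradient difference; the descent lemma gains a quadratic term. Exchanging `x`
and `y` and adding gives the claim. -/
theorem gradient_cocoercive {H : F → ℝ} (hconv : ConvexOn ℝ Set.univ H)
    (hH : Differentiable ℝ H) {β : ℝ} (hβ : 0 < β)
    (hlip : LipschitzWith (Real.toNNReal β⁻¹) (gradient H)) (x y : F) :
    β * ‖gradient H x - gradient H y‖ ^ 2 ≤ inner ℝ (gradient H x - gradient H y) (x - y) := by
  have key : ∀ x y, H y + inner ℝ (gradient H y) (x - y)
      + β / 2 * ‖gradient H x - gradient H y‖ ^ 2 ≤ H x := by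
    intro x y
    have h1 := le_add_inner_gradient_add_sq hH hlip x (-(β • (gradient H x - gradient H y)))
    have h2 := add_inner_gradient_le hconv hH y (x + -(β • (gradient H x - gradient H y)))
    have e : x + -(β • (gradient H x - gradient H y)) - y
      = (x - y) - β • (gradient H x - gradient H y) := by abel
    rw [e, inner_sub_right, inner_smul_right] at h2
    rw [Real.coe_toNNReal _ (inv_nonneg.2 hβ.le), inner_neg_right, inner_smul_right, norm_neg,
      norm_smul, Real.norm_of_nonneg hβ.le] at h1
    have e2 : β⁻¹ / 2 * (β * ‖gradient H x - gradient H y‖) ^ 2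
      = β / 2 * ‖gradient H x - gradient H y‖ ^ 2 := by field_simp
    have e3 := real_inner_self_eq_norm_sq (gradient H x - gradient H y)
    rw [inner_sub_left] at e3
    rw [e2] at h1
    have e4 := congrArg (fun s => β * s) e3
    simp only [mul_sub] at e4
    linarith
  have h1 := key x y
  have h2 := key y x
  rw [norm_sub_rev, ← neg_sub x y, inner_neg_right] at h2
  rw [inner_sub_left]
  linarith

theorem eq_gradient_of_mem_convexSubdifferential {H : F → ℝ} (hH : Differentiable ℝ H) {x g : F}
    (hg : g ∈ convexSubdifferential H x) : g = gradient H x := by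
  have key : ∀ d, inner ℝ (g - gradient H x) d ≤ 0 := by
    intro d
    have h := ((hasDerivAt_id (0 : ℝ)).mul_const (inner ℝ g d)).sub (hasDerivAt_comp_line hH x d 0)
    simp only [zero_smul, add_zero, one_mul] at h
    rw [inner_sub_left]
    refine nonpos_of_hasDerivAt_of_le h fun t _ _ => ?_
    have := hg (x + t • d)
    rw [add_sub_cancel_left, inner_smul_right] at this
    simp only [Pi.sub_apply, id_eq, zero_smul, add_zero, zero_mul]
    linarith
  have := key (g - gradient H x)
  rw [real_inner_self_eq_norm_sq] at this
  exact sub_eq_zero.1 (norm_eq_zero.1 (pow_eq_zero_iff two_ne_zero |>.1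
    (le_antisymm this (sq_nonneg _))))

theorem inner_sub_metricProj_le {C : Set F} (hne : C.Nonempty) (hcl : IsClosed C)
    (hco : Convex ℝ C) (x : F) {z : F} (hz : z ∈ C) :
    inner ℝ (x - metricProj C x) (z - metricProj C x) ≤ 0 := by
  obtain ⟨hp, hm⟩ := metricProj_spec hne hcl hco x
  refine (norm_eq_iInf_iff_real_inner_le_zero hco hp).1 (le_antisymm ?_ ?_) z hz
  · have : Nonempty C := ⟨⟨_, hp⟩⟩
    exact le_ciInf fun z => hm z z.2
  · exact ciInf_le ⟨0, by rintro _ ⟨w, rfl⟩; exact norm_nonneg _⟩ (⟨_, hp⟩ : C)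

theorem metricProj_submodule (V : Submodule ℝ F) [V.HasOrthogonalProjection]
    (hV : IsClosed (V : Set F)) (x : F) : metricProj (V : Set F) x = V.starProjection x := by
  refine metricProj_unique ⟨0, V.zero_mem⟩ hV V.convex x _ (V.starProjection_apply_mem x)
    fun z hz => ?_
  rw [V.starProjection_minimal x]
  exact ciInf_le ⟨0, by rintro _ ⟨w, rfl⟩; exact norm_nonneg _⟩ (⟨z, hz⟩ : V)

/-- A closed convex set is weakly closed: the half-space supporting it at the projection of `a`
contains every `q i`, hence the weak limit. -/
theorem mem_of_tendsto_inner {ι : Type*} {l : Filter ι} [l.NeBot] {C : Set F}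
    (hcl : IsClosed C) (hco : Convex ℝ C) {q : ι → F} (hq : ∀ i, q i ∈ C) {a : F}
    (ha : ∀ v, Tendsto (fun i => inner ℝ v (q i)) l (𝓝 (inner ℝ v a))) : a ∈ C := by
  obtain ⟨i⟩ := l.nonempty_of_neBot
  have hne : C.Nonempty := ⟨q i, hq i⟩
  have h : inner ℝ (a - metricProj C a) (a - metricProj C a) ≤ (0 : ℝ) := by
    have h1 := (ha (a - metricProj C a)).sub_const (inner ℝ (a - metricProj C a) (metricProj C a))
    rw [← inner_sub_right] at h1
    refine le_of_tendsto h1 (Eventually.of_forall fun i => ?_)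
    rw [← inner_sub_right]
    exact inner_sub_metricProj_le hne hcl hco a (hq i)
  rw [real_inner_self_eq_norm_sq] at h
  rw [sub_eq_zero.1 (norm_eq_zero.1 (pow_eq_zero_iff two_ne_zero |>.1
    (le_antisymm h (sq_nonneg _))))]
  exact (metricProj_spec hne hcl hco a).1

/-- Banach–Alaoglu carried over by the Riesz isometry. Ultrafilters take the place of subsequences.
-/
theorem Ultrafilter.exists_tendsto_inner {ι : Type*} (U : Ultrafilter ι) {z : ι → F} {C : ℝ}
    (hz : ∀ i, ‖z i‖ ≤ C) :
    ∃ a, ∀ v, Tendsto (fun i => inner ℝ v (z i)) U (𝓝 (inner ℝ v a)) := by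
  have hc := WeakDual.isCompact_closedBall (𝕜 := ℝ) (E := F) 0 C
  obtain ⟨φ, -, hφ⟩ := hc.ultrafilter_le_nhds
    (U.map fun i => StrongDual.toWeakDual (InnerProductSpace.toDual ℝ F (z i))) (by
      rw [le_principal_iff]
      refine Filter.mem_map.2 (Filter.univ_mem' fun i => ?_)
      simpa using hz i)
  refine ⟨(InnerProductSpace.toDual ℝ F).symm (WeakDual.toStrongDual φ), fun v => ?_⟩
  have h : Tendsto (fun i => StrongDual.toWeakDual (InnerProductSpace.toDual ℝ F (z i))) U (𝓝 φ) :=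
    hφ
  have h2 := (tendsto_iff_forall_eval_tendsto_topDualPairing.1 h) v
  rw [real_inner_comm, InnerProductSpace.toDual_symm_apply]
  refine h2.congr fun i => ?_
  rw [real_inner_comm]
  rfl

theorem tendstoWeakly_of_tendsto_inner {x : ℕ → F} {a : F}
    (h : ∀ v, Tendsto (fun k => inner ℝ v (x k)) atTop (𝓝 (inner ℝ v a))) :
    TendstoWeakly x a := by
  refine (WeakBilin.tendsto_iff_forall_eval_tendsto (topDualPairing ℝ F).flip ?_).2 fun φ => ?_
  · intro y z hyz
    refine ext_inner_left ℝ fun v => ?_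
    have := DFunLike.congr_fun hyz (InnerProductSpace.toDual ℝ F v)
    exact this
  · have := h ((InnerProductSpace.toDual ℝ F).symm φ)
    simp only [InnerProductSpace.toDual_symm_apply] at this
    exact this

end Gradient

end GeneralLemmas

/-! ### Energy decrease for one step. -/

section PrimalDual

variable {F : Type*} [NormedAddCommGroup F] [InnerProductSpace ℝ F]

theorem inner_nonneg_of_mem_convexSubdifferential {f : F → ℝ} {x y g h : F}
    (hg : g ∈ convexSubdifferential f x) (hh : h ∈ convexSubdifferential f y) :
    0 ≤ inner ℝ (g - h) (x - y) := by
  have h1 := hg y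
  have h2 := hh x
  rw [← neg_sub x y, inner_neg_right] at h1
  rw [inner_sub_left]
  linarith

theorem inner_nonneg_of_mem_convexNormalCone {C : Set F} {x y g h : F}
    (hg : g ∈ convexNormalCone C x) (hh : h ∈ convexNormalCone C y) :
    0 ≤ inner ℝ (g - h) (x - y) := by
  have h1 := hg.2 y hh.1
  have h2 := hh.2 x hg.1
  rw [← neg_sub x y, inner_neg_right] at h1
  rw [inner_sub_left]
  linarith

theorem inner_le_weighted_sq (a b : F) {c : ℝ} (hc : 0 < c) :
    inner ℝ a b ≤ 1 / (2 * c) * ‖a‖ ^ 2 + c / 2 * ‖b‖ ^ 2 := by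
  have h1 := real_inner_le_norm a b
  have h2 : 0 ≤ 1 / (2 * c) * (‖a‖ - c * ‖b‖) ^ 2 := by positivity
  have h3 : 1 / (2 * c) * (‖a‖ - c * ‖b‖) ^ 2
      = 1 / (2 * c) * ‖a‖ ^ 2 + c / 2 * ‖b‖ ^ 2 - ‖a‖ * ‖b‖ := by
    field_simp
    ring
  linarith

/-- The Lyapunov function of the primal-dual iteration, in terms of the errors `A`, `B`, `U` of the
primal, subspace-dual and constraint-dual variables and of the last primal increment `S`. -/
noncomputable def primalDualEnergy (lam γ c : ℝ) (A S B U : F) : ℝ :=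
  1 / (2 * lam) * ‖A‖ ^ 2 + lam / 2 * ‖B‖ ^ 2 + 1 / (2 * γ) * ‖U‖ ^ 2 + inner ℝ U S
    + c / 2 * ‖S‖ ^ 2

/-- `δ` is a decrease rate of the energy with weight `c`, for the Young parameter `κ`. -/
structure IsDecreaseRate (lam γ β c κ δ : ℝ) : Prop where
  c_pos : 0 < c
  kappa_pos : 0 < κ
  delta_pos : 0 < δ
  primal : δ ≤ 1 / (2 * lam) - κ / 2 - c / 2
  dual : δ ≤ 1 / (2 * γ) - 1 / (2 * c)
  subspace : δ ≤ lam / 2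
  smooth : δ ≤ β - 1 / (2 * κ)

theorem exists_isDecreaseRate {lam γ β : ℝ} (hβ : 0 < β) (hlam : 0 < lam) (hγ : 0 < γ)
    (h : γ < 1 / lam - 1 / (2 * β)) : ∃ c κ δ, IsDecreaseRate lam γ β c κ δ := by
  -- The slack `m` is split in three: one third makes `κ > 1 / (2 * β)`, one makes `c > γ`, and the
  -- last, halved, is the `m / 6` left for the primal increment.
  obtain ⟨m, hm⟩ : ∃ m, m = 1 / lam - 1 / (2 * β) - γ := ⟨_, rfl⟩
  have hm0 : 0 < m := by linarith
  have hb : 0 < 1 / (2 * β) := by positivity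
  obtain ⟨κ, hκ⟩ : ∃ κ, κ = 1 / (2 * β) + m / 3 := ⟨_, rfl⟩
  have hκ0 : 0 < κ := by linarith
  have h1 : 0 < 1 / (2 * γ) - 1 / (2 * (γ + m / 3)) :=
    sub_pos.2 (one_div_lt_one_div_of_lt (by linarith) (by linarith))
  have h2 : 0 < β - 1 / (2 * κ) := by
    have : 1 / κ < 1 / (1 / (2 * β)) := one_div_lt_one_div_of_lt hb (by linarith)
    rw [one_div_one_div] at this
    have e : 1 / (2 * κ) = (1 / κ) / 2 := by field_simp
    linarith
  have e : 1 / (2 * lam) = (1 / lam) / 2 := by field_simp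
  refine ⟨γ + m / 3, κ, min (min (m / 6) (1 / (2 * γ) - 1 / (2 * (γ + m / 3))))
    (min (lam / 2) (β - 1 / (2 * κ))), by linarith, hκ0, ?_, ?_, ?_, ?_, ?_⟩
  · exact lt_min (lt_min (by linarith) h1) (lt_min (by linarith) h2)
  · refine ((min_le_left _ _).trans (min_le_left _ _)).trans ?_
    rw [e, hκ]
    linarith
  · exact (min_le_left _ _).trans (min_le_right _ _)
  · exact (min_le_right _ _).trans (min_le_left _ _)
  · exact (min_le_right _ _).trans (min_le_right _ _)

theorem IsDecreaseRate.le_primalDualEnergy {lam γ β c κ δ : ℝ}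
    (h : IsDecreaseRate lam γ β c κ δ) (A S B U : F) :
    δ * (‖A‖ ^ 2 + ‖B‖ ^ 2 + ‖U‖ ^ 2) ≤ primalDualEnergy lam γ c A S B U := by
  have h1 := inner_le_weighted_sq (-U) S h.c_pos
  rw [inner_neg_left, norm_neg] at h1
  have hc := h.c_pos
  have hk := h.kappa_pos
  have hA : δ ≤ 1 / (2 * lam) := by linarith [h.primal]
  have h2 := mul_le_mul_of_nonneg_right hA (sq_nonneg ‖A‖)
  have h3 := mul_le_mul_of_nonneg_right h.subspace (sq_nonneg ‖B‖)
  have h4 := mul_le_mul_of_nonneg_right h.dual (sq_nonneg ‖U‖)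
  rw [sub_mul] at h4
  unfold primalDualEnergy
  linarith

/-- `A`, `B`, `U` are the current errors, `D`, `T`, `W` the new increments, `S` the previous primal
increment and `d` the gradient error. Adding `h1` and `h2` cancels `⟪U + W, A⟫`. The coupling left
is `⟪U, S⟫ - ⟪U + W, D⟫`, which telescopes inside the energy, and `⟪W, S⟫` and `-⟪d, D⟫`, which
Young's inequality absorbs with weights `c` and `κ`. -/
theorem primalDualEnergy_step {V : Submodule ℝ F} [V.HasOrthogonalProjection]
    {lam γ β c κ δ : ℝ} (hδ : IsDecreaseRate lam γ β c κ δ)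
    {A D S B T U W d : F} (hA : A ∈ V) (hD : D ∈ V) (hB : B ∈ Vᗮ) (hT : T ∈ Vᗮ)
    (h1 : 0 ≤ inner ℝ (-(lam⁻¹ • D) + B + T - V.starProjection (U + W + d)) (A + D - lam • T))
    (h2 : 0 ≤ inner ℝ (U + W) (A + S - γ⁻¹ • W))
    (h3 : β * ‖d‖ ^ 2 ≤ inner ℝ d A) :
    primalDualEnergy lam γ c (A + D) D (B + T) (U + W)
      + δ * (‖D‖ ^ 2 + ‖T‖ ^ 2 + ‖W‖ ^ 2 + ‖d‖ ^ 2) ≤ primalDualEnergy lam γ c A S B U := by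
  have hP : V.starProjection (A + D - lam • T) = A + D := by
    rw [map_sub, map_smul, V.starProjection_eq_self_iff.2 (V.add_mem hA hD),
      (V.starProjection_apply_eq_zero_iff).2 hT, smul_zero, sub_zero]
  rw [inner_sub_left, V.inner_starProjection_left_eq_right, hP] at h1
  have o1 : inner ℝ D T = (0 : ℝ) := Submodule.inner_right_of_mem_orthogonal hD hT
  have o2 : inner ℝ B A = (0 : ℝ) := Submodule.inner_left_of_mem_orthogonal hA hB
  have o3 : inner ℝ B D = (0 : ℝ) := Submodule.inner_left_of_mem_orthogonal hD hB
  have o4 : inner ℝ T A = (0 : ℝ) := Submodule.inner_left_of_mem_orthogonal hA hT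
  have o5 : inner ℝ T D = (0 : ℝ) := Submodule.inner_left_of_mem_orthogonal hD hT
  simp only [inner_add_left, inner_add_right, inner_sub_right, inner_neg_left, inner_smul_left,
    inner_smul_right, o1, o2, o3, o4, o5, real_inner_self_eq_norm_sq, RCLike.conj_to_real] at h1 h2
  have y1 := inner_le_weighted_sq W S hδ.c_pos
  have y2 := inner_le_weighted_sq (-d) D hδ.kappa_pos
  rw [inner_neg_left, norm_neg] at y2
  have b1 := mul_le_mul_of_nonneg_right hδ.primal (sq_nonneg ‖D‖)
  have b2 := mul_le_mul_of_nonneg_right hδ.subspace (sq_nonneg ‖T‖)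
  have b3 := mul_le_mul_of_nonneg_right hδ.dual (sq_nonneg ‖W‖)
  have b4 := mul_le_mul_of_nonneg_right hδ.smooth (sq_nonneg ‖d‖)
  have i1 : 1 / (2 * lam) = lam⁻¹ / 2 := by ring
  have i2 : 1 / (2 * γ) = γ⁻¹ / 2 := by ring
  unfold primalDualEnergy
  rw [norm_add_sq_real, norm_add_sq_real, norm_add_sq_real, inner_add_left, i1, i2]
  rw [i1] at b1
  rw [i2] at b3
  rw [real_inner_comm] at h1
  simp only [mul_zero, real_inner_comm D A] at h1 ⊢
  linarith

end PrimalDual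

/-! ### Consequences of the energy decrease along the sequence. -/

section PrimalDualSequence

variable {F : Type*} [NormedAddCommGroup F] [InnerProductSpace ℝ F] [CompleteSpace F]

/-- The primal-dual optimality system: `x` is the primal variable, `u` the multiplier of `C` and
`y` the component in `Vᗮ` of the subgradient of `f`. -/
structure IsPrimalDualSolution (f H : F → ℝ) (C : Set F) (V : Submodule ℝ F)
    [V.HasOrthogonalProjection] (x y u : F) : Prop where
  x_mem : x ∈ V
  y_mem : y ∈ Vᗮ
  u_mem : u ∈ convexNormalCone C x
  sub_mem : y - V.starProjection (u + gradient H x) ∈ convexSubdifferential f x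

/-- The primal-dual iteration in inclusion form. For `k = 0` the term `x k - x (k - 1)` is `0`. -/
structure IsPrimalDualSequence (f H : F → ℝ) (C : Set F) (V : Submodule ℝ F)
    [V.HasOrthogonalProjection] (lam γ : ℝ) (x y u w q : ℕ → F) : Prop where
  x_mem : ∀ k, x k ∈ V
  y_mem : ∀ k, y k ∈ Vᗮ
  w_eq : ∀ k, w k = x (k + 1) - lam • (y (k + 1) - y k)
  q_eq : ∀ k, q k = x k + (x k - x (k - 1)) - γ⁻¹ • (u (k + 1) - u k)
  u_mem : ∀ k, u (k + 1) ∈ convexNormalCone C (q k)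
  sub_mem : ∀ k, -(lam⁻¹ • (x (k + 1) - x k)) + y (k + 1)
    - V.starProjection (u (k + 1) + gradient H (x k)) ∈ convexSubdifferential f (w k)

namespace IsPrimalDualSequence

variable {f H : F → ℝ} {C : Set F} {V : Submodule ℝ F} [V.HasOrthogonalProjection]
  {lam γ β c κ δ : ℝ} {x y u w q : ℕ → F} {xs ys us : F}

theorem energy_step (hs : IsPrimalDualSequence f H C V lam γ x y u w q)
    (hsol : IsPrimalDualSolution f H C V xs ys us) (hδ : IsDecreaseRate lam γ β c κ δ)
    (hco : ∀ a b, β * ‖gradient H a - gradient H b‖ ^ 2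
      ≤ inner ℝ (gradient H a - gradient H b) (a - b)) (k : ℕ) :
    primalDualEnergy lam γ c (x (k + 1) - xs) (x (k + 1) - x k) (y (k + 1) - ys) (u (k + 1) - us)
      + δ * (‖x (k + 1) - x k‖ ^ 2 + ‖y (k + 1) - y k‖ ^ 2 + ‖u (k + 1) - u k‖ ^ 2
        + ‖gradient H (x k) - gradient H xs‖ ^ 2)
      ≤ primalDualEnergy lam γ c (x k - xs) (x k - x (k - 1)) (y k - ys) (u k - us) := by
  have h1 := inner_nonneg_of_mem_convexSubdifferential (hs.sub_mem k) hsol.sub_mem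
  have h2 := inner_nonneg_of_mem_convexNormalCone (hs.u_mem k) hsol.u_mem
  have h := primalDualEnergy_step (V := V) (lam := lam) (γ := γ) hδ (A := x k - xs)
    (D := x (k + 1) - x k) (S := x k - x (k - 1)) (B := y k - ys) (T := y (k + 1) - y k)
    (U := u k - us) (W := u (k + 1) - u k) (d := gradient H (x k) - gradient H xs)
    (V.sub_mem (hs.x_mem _) hsol.x_mem) (V.sub_mem (hs.x_mem _) (hs.x_mem _))
    (Vᗮ.sub_mem (hs.y_mem _) hsol.y_mem) (Vᗮ.sub_mem (hs.y_mem _) (hs.y_mem _))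
    (by
      convert h1 using 2
      · simp only [map_add, map_sub]
        abel
      · rw [hs.w_eq]
        abel)
    (by
      convert h2 using 2
      · abel
      · rw [hs.q_eq]
        abel)
    (hco _ _)
  have e1 : x k - xs + (x (k + 1) - x k) = x (k + 1) - xs := by abel
  have e2 : y k - ys + (y (k + 1) - y k) = y (k + 1) - ys := by abel
  have e3 : u k - us + (u (k + 1) - u k) = u (k + 1) - us := by abel
  rwa [e1, e2, e3] at h

theorem exists_tendsto_energy (hs : IsPrimalDualSequence f H C V lam γ x y u w q)
    (hsol : IsPrimalDualSolution f H C V xs ys us) (hδ : IsDecreaseRate lam γ β c κ δ)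
    (hco : ∀ a b, β * ‖gradient H a - gradient H b‖ ^ 2
      ≤ inner ℝ (gradient H a - gradient H b) (a - b)) :
    ∃ L, Tendsto (fun k => primalDualEnergy lam γ c (x k - xs) (x k - x (k - 1)) (y k - ys)
      (u k - us)) atTop (𝓝 L) := by
  refine ⟨_, tendsto_atTop_ciInf (antitone_nat_of_succ_le fun k => ?_) ⟨0, ?_⟩⟩
  · have h := hs.energy_step hsol hδ hco k
    have := hδ.delta_pos
    refine le_trans ?_ h
    rw [Nat.add_sub_cancel]
    exact le_add_of_nonneg_right (by positivity)
  · rintro _ ⟨k, rfl⟩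
    have := hδ.delta_pos
    exact le_trans (by positivity) (hδ.le_primalDualEnergy _ _ _ _)

theorem tendsto_residuals (hs : IsPrimalDualSequence f H C V lam γ x y u w q)
    (hsol : IsPrimalDualSolution f H C V xs ys us) (hδ : IsDecreaseRate lam γ β c κ δ)
    (hco : ∀ a b, β * ‖gradient H a - gradient H b‖ ^ 2
      ≤ inner ℝ (gradient H a - gradient H b) (a - b)) :
    Tendsto (fun k => x (k + 1) - x k) atTop (𝓝 0) ∧
    Tendsto (fun k => y (k + 1) - y k) atTop (𝓝 0) ∧
    Tendsto (fun k => u (k + 1) - u k) atTop (𝓝 0) ∧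
    Tendsto (fun k => gradient H (x k)) atTop (𝓝 (gradient H xs)) := by
  obtain ⟨L, hL⟩ := hs.exists_tendsto_energy hsol hδ hco
  -- Consecutive energies have the same limit, so their difference, which dominates all squared
  -- residuals, tends to zero.
  have hdiff := (hL.sub ((tendsto_add_atTop_iff_nat 1).2 hL)).const_mul δ⁻¹
  rw [sub_self, mul_zero] at hdiff
  have hle : ∀ k, ‖x (k + 1) - x k‖ ^ 2 + ‖y (k + 1) - y k‖ ^ 2 + ‖u (k + 1) - u k‖ ^ 2
        + ‖gradient H (x k) - gradient H xs‖ ^ 2 ≤ _ := fun k =>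
    (le_inv_mul_iff₀ hδ.delta_pos).2 (le_sub_iff_add_le'.2 (hs.energy_step hsol hδ hco k))
  have key : ∀ r : ℕ → F, (∀ k, ‖r k‖ ^ 2 ≤ ‖x (k + 1) - x k‖ ^ 2 + ‖y (k + 1) - y k‖ ^ 2
      + ‖u (k + 1) - u k‖ ^ 2 + ‖gradient H (x k) - gradient H xs‖ ^ 2) →
      Tendsto r atTop (𝓝 0) := by
    intro r hr
    have h2 := squeeze_zero (fun k => sq_nonneg ‖r k‖) (fun k => (hr k).trans (hle k)) hdiff
    have h3 := h2.sqrt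
    simp only [Real.sqrt_sq (norm_nonneg _), Real.sqrt_zero] at h3
    exact tendsto_zero_iff_norm_tendsto_zero.2 h3
  refine ⟨key _ fun k => ?_, key _ fun k => ?_, key _ fun k => ?_,
    tendsto_sub_nhds_zero_iff.1 (key _ fun k => ?_)⟩ <;>
  nlinarith only [sq_nonneg ‖x (k + 1) - x k‖, sq_nonneg ‖y (k + 1) - y k‖,
    sq_nonneg ‖u (k + 1) - u k‖, sq_nonneg ‖gradient H (x k) - gradient H xs‖]

theorem exists_bound (hs : IsPrimalDualSequence f H C V lam γ x y u w q)
    (hsol : IsPrimalDualSolution f H C V xs ys us) (hδ : IsDecreaseRate lam γ β c κ δ)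
    (hco : ∀ a b, β * ‖gradient H a - gradient H b‖ ^ 2
      ≤ inner ℝ (gradient H a - gradient H b) (a - b)) :
    ∃ R, ∀ k, ‖x k‖ ≤ R ∧ ‖y k‖ ≤ R ∧ ‖u k‖ ≤ R := by
  obtain ⟨L, hL⟩ := hs.exists_tendsto_energy hsol hδ hco
  obtain ⟨M, hM⟩ := hL.bddAbove_range
  have hle : ∀ k, ‖x k - xs‖ ^ 2 + ‖y k - ys‖ ^ 2 + ‖u k - us‖ ^ 2 ≤ δ⁻¹ * M := fun k =>
    (le_inv_mul_iff₀ hδ.delta_pos).2 ((hδ.le_primalDualEnergy _ _ _ _).trans (hM ⟨k, rfl⟩))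
  have key : ∀ a b : F, ‖a - b‖ ^ 2 ≤ δ⁻¹ * M →
      ‖b‖ ≤ ‖xs‖ + ‖ys‖ + ‖us‖ → ‖a‖ ≤ √(δ⁻¹ * M) + (‖xs‖ + ‖ys‖ + ‖us‖) := by
    intro a b h hb
    have := norm_le_norm_sub_add a b
    linarith [Real.le_sqrt_of_sq_le h]
  have n1 := norm_nonneg xs
  have n2 := norm_nonneg ys
  have n3 := norm_nonneg us
  refine ⟨√(δ⁻¹ * M) + (‖xs‖ + ‖ys‖ + ‖us‖), fun k => ⟨key _ xs ?_ ?_, key _ ys ?_ ?_,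
    key _ us ?_ ?_⟩⟩ <;>
  linarith [hle k, sq_nonneg ‖x k - xs‖, sq_nonneg ‖y k - ys‖, sq_nonneg ‖u k - us‖]

end IsPrimalDualSequence

end PrimalDualSequence

/-! ### Weak cluster points solve the optimality system. -/

section WeakLimits

variable {F : Type*} [NormedAddCommGroup F] [InnerProductSpace ℝ F]

theorem tendsto_inner_of_weak_of_strong {ι : Type*} {l : Filter ι} {a b : ι → F} {a₀ b₀ : F} {R : ℝ}
    (hR : ∀ i, ‖a i‖ ≤ R) (ha : ∀ v, Tendsto (fun i => inner ℝ v (a i)) l (𝓝 (inner ℝ v a₀)))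
    (hb : Tendsto b l (𝓝 b₀)) :
    Tendsto (fun i => inner ℝ (a i) (b i)) l (𝓝 (inner ℝ a₀ b₀)) := by
  have h1 : Tendsto (fun i => inner ℝ (a i) (b i - b₀)) l (𝓝 0) := by
    have h2 : Tendsto (fun i => R * ‖b i - b₀‖) l (𝓝 0) := by
      simpa using (tendsto_sub_nhds_zero_iff.2 hb).norm.const_mul R
    refine squeeze_zero_norm (fun i => ?_) h2
    exact (norm_inner_le_norm _ _).trans (mul_le_mul_of_nonneg_right (hR i) (norm_nonneg _))
  have h3 := h1.add (ha b₀)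
  rw [zero_add, real_inner_comm] at h3
  refine h3.congr fun i => ?_
  rw [inner_sub_right, real_inner_comm (a i) b₀, sub_add_cancel]

theorem tendsto_inner_of_sub_tendsto_zero {ι : Type*} {l : Filter ι} {a b : ι → F} {a₀ : F}
    (ha : ∀ v, Tendsto (fun i => inner ℝ v (a i)) l (𝓝 (inner ℝ v a₀)))
    (hab : Tendsto (fun i => b i - a i) l (𝓝 0)) (v : F) :
    Tendsto (fun i => inner ℝ v (b i)) l (𝓝 (inner ℝ v a₀)) := by
  have h1 : Tendsto (fun i => inner ℝ v (b i - a i)) l (𝓝 (inner ℝ v 0)) :=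
    tendsto_const_nhds.inner hab
  have h := h1.add (ha v)
  rw [inner_zero_right, zero_add] at h
  refine h.congr fun i => ?_
  rw [inner_sub_right, sub_add_cancel]

variable [CompleteSpace F]

namespace IsPrimalDualSequence

variable {f H : F → ℝ} {C : Set F} {V : Submodule ℝ F} [V.HasOrthogonalProjection]
  {lam γ : ℝ} {x y u w q : ℕ → F} {x₀ y₀ u₀ : F}

theorem isPrimalDualSolution_of_tendsto (hs : IsPrimalDualSequence f H C V lam γ x y u w q)
    (hf : ∀ x, (convexSubdifferential f x).Nonempty)
    (hconv : ConvexOn ℝ Set.univ H) (hdiff : Differentiable ℝ H)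
    (hCcl : IsClosed C) (hCco : Convex ℝ C)
    (hx0 : Tendsto (fun k => x (k + 1) - x k) atTop (𝓝 0))
    (hy0 : Tendsto (fun k => y (k + 1) - y k) atTop (𝓝 0))
    (hu0 : Tendsto (fun k => u (k + 1) - u k) atTop (𝓝 0))
    {g : F} (hg : Tendsto (fun k => gradient H (x k)) atTop (𝓝 g))
    {R : ℝ} (hR : ∀ k, ‖x k‖ ≤ R ∧ ‖y k‖ ≤ R ∧ ‖u k‖ ≤ R)
    {l : Filter ℕ} [l.NeBot] (hl : l ≤ atTop)
    (hx : ∀ v, Tendsto (fun k => inner ℝ v (x k)) l (𝓝 (inner ℝ v x₀)))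
    (hy : ∀ v, Tendsto (fun k => inner ℝ v (y k)) l (𝓝 (inner ℝ v y₀)))
    (hu : ∀ v, Tendsto (fun k => inner ℝ v (u k)) l (𝓝 (inner ℝ v u₀))) :
    IsPrimalDualSolution f H C V x₀ y₀ u₀ := by
  have hS : Tendsto (fun k => x k - x (k - 1)) l (𝓝 0) :=
    ((tendsto_add_atTop_iff_nat 1).1 hx0).mono_left hl
  replace hx0 := hx0.mono_left hl
  replace hy0 := hy0.mono_left hl
  replace hu0 := hu0.mono_left hl
  replace hg := hg.mono_left hl
  have hx' := tendsto_inner_of_sub_tendsto_zero hx hx0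
  have hy' := tendsto_inner_of_sub_tendsto_zero hy hy0
  have hu' := tendsto_inner_of_sub_tendsto_zero hu hu0
  have hw : ∀ v, Tendsto (fun k => inner ℝ v (w k)) l (𝓝 (inner ℝ v x₀)) := by
    refine tendsto_inner_of_sub_tendsto_zero hx' ?_
    have h := (hy0.const_smul lam).neg
    rw [smul_zero, neg_zero] at h
    refine h.congr fun k => ?_
    rw [hs.w_eq]
    abel
  have hq : ∀ v, Tendsto (fun k => inner ℝ v (q k)) l (𝓝 (inner ℝ v x₀)) := by
    refine tendsto_inner_of_sub_tendsto_zero hx ?_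
    have h := hS.sub (hu0.const_smul γ⁻¹)
    rw [smul_zero, sub_zero] at h
    refine h.congr fun k => ?_
    rw [hs.q_eq]
    abel
  have hxV : x₀ ∈ V := by
    -- `Vᗮᗮ` is closed by construction and equals `V` because `V` has an orthogonal projection.
    have h := mem_of_tendsto_inner (C := (Vᗮᗮ : Submodule ℝ F)) (Submodule.isClosed_orthogonal _)
      (Submodule.convex _) (fun k => V.le_orthogonal_orthogonal (hs.x_mem k)) hx
    rwa [SetLike.mem_coe, Submodule.orthogonal_orthogonal] at h
  have hyV : y₀ ∈ Vᗮ :=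
    mem_of_tendsto_inner (C := Vᗮ) (Submodule.isClosed_orthogonal _)
      (Submodule.convex _) hs.y_mem hy
  have hxC : x₀ ∈ C := mem_of_tendsto_inner hCcl hCco (fun k => (hs.u_mem k).1) hq
  have hgrad : g = gradient H x₀ := by
    refine eq_gradient_of_mem_convexSubdifferential hdiff fun z => ?_
    -- The tangent of `H` at `x₀` is a weakly continuous minorant, so it replaces weak lower
    -- semicontinuity of `H` in the limit; `g` becomes a subgradient at `x₀`.
    have h1 := (((hx (gradient H x₀)).sub_const (inner ℝ (gradient H x₀) x₀)).const_add (H x₀)).add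
      ((hg.inner (tendsto_const_nhds (x := z))).sub (tendsto_inner_of_weak_of_strong
        (fun k => (hR k).1) hx hg))
    have h2 := le_of_tendsto h1 (Eventually.of_forall fun k => (show _ ≤ H z by
      have e1 := add_inner_gradient_le hconv hdiff x₀ (x k)
      have e2 := add_inner_gradient_le hconv hdiff (x k) z
      rw [inner_sub_right] at e1 e2
      rw [real_inner_comm (gradient H (x k)) (x k)]
      linarith))
    rw [inner_sub_right, real_inner_comm x₀ g]
    linarith
  -- A subgradient at the limit bounds `f (w k)` below by a weakly continuous affine function.
  obtain ⟨s, hsub⟩ := hf x₀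
  -- The two inclusions are tested at independent points `z` and `t`. Summing them removes `⟪u (k +
  -- 1), x (k + 1)⟫`, the only pairing of two merely weak limits; every other product has a strongly
  -- convergent factor, or vanishes by orthogonality. Choosing `z = x₀` or `t = x₀` later separates
  -- the two inclusions.
  have key : ∀ z, ∀ t ∈ C, f x₀ + inner ℝ (y₀ - V.starProjection (u₀ + g)) z + inner ℝ u₀ t
      + inner ℝ g x₀ ≤ f z := by
    intro z t ht
    have a1 := tendsto_inner_of_weak_of_strong (fun k => (hR (k + 1)).1) hx' (hx0.const_smul lam⁻¹)
    have a2 := tendsto_inner_of_weak_of_strong (fun k => (hR (k + 1)).2.1) hy' (hy0.const_smul lam)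
    have a3 := tendsto_inner_of_weak_of_strong (fun k => (hR (k + 1)).1) hx' hg
    have a4 := tendsto_inner_of_weak_of_strong (fun k => (hR (k + 1)).2.2) hu'
      ((hx0.sub hS).add (hu0.const_smul γ⁻¹))
    have a5 := (hw s).sub_const (inner ℝ s x₀)
    have a6 := (((hx0.const_smul lam⁻¹).inner (tendsto_const_nhds (x := z))).neg.add
      ((hy' z).sub ((hu' (V.starProjection z)).add
      (hg.inner (tendsto_const_nhds (x := V.starProjection z))))))
    have a := ((a5.const_add (f x₀)).add (a6.add (hu' t))).add (((a1.add a2).add a3).add a4)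
    have := le_of_tendsto a (Eventually.of_forall fun k => (show _ ≤ f z by
      have e1 := hs.sub_mem k z
      have e2 := (hs.u_mem k).2 t ht
      have e3 := hsub (w k)
      have hxk := hs.x_mem (k + 1)
      have o1 : inner ℝ (y (k + 1)) (x (k + 1)) = (0 : ℝ) :=
        Submodule.inner_left_of_mem_orthogonal hxk (hs.y_mem _)
      have hPw : V.starProjection (w k) = x (k + 1) := by
        rw [hs.w_eq, map_sub, map_smul, V.starProjection_eq_self_iff.2 hxk,
          (V.starProjection_apply_eq_zero_iff).2 (Vᗮ.sub_mem (hs.y_mem _) (hs.y_mem _)),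
          smul_zero, sub_zero]
      have o2 : inner ℝ (x (k + 1) - x k) (y (k + 1) - y k) = (0 : ℝ) :=
        Submodule.inner_right_of_mem_orthogonal (V.sub_mem hxk (hs.x_mem k))
          (Vᗮ.sub_mem (hs.y_mem _) (hs.y_mem _))
      have p1 : inner ℝ (-(lam⁻¹ • (x (k + 1) - x k)) + y (k + 1)
          - V.starProjection (u (k + 1) + gradient H (x k))) (w k)
          = -inner ℝ (x (k + 1)) (lam⁻¹ • (x (k + 1) - x k))
            - inner ℝ (y (k + 1)) (lam • (y (k + 1) - y k))
            - inner ℝ (u (k + 1)) (x (k + 1)) - inner ℝ (x (k + 1)) (gradient H (x k)) := by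
        rw [inner_sub_left, V.inner_starProjection_left_eq_right, hPw, inner_add_left, hs.w_eq,
          inner_neg_left, inner_smul_left, inner_sub_right (x (k + 1) - x k), inner_smul_right,
          o2, inner_sub_right (y (k + 1)), o1, inner_add_left, inner_smul_right (x (k + 1)),
          real_inner_comm (x (k + 1)) (x (k + 1) - x k),
          real_inner_comm (x (k + 1)) (gradient H (x k))]
        simp only [RCLike.conj_to_real]
        ring
      have p2 : inner ℝ (u (k + 1)) (q k) = inner ℝ (u (k + 1)) (x (k + 1))
          - inner ℝ (u (k + 1)) (x (k + 1) - x k - (x k - x (k - 1))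
            + γ⁻¹ • (u (k + 1) - u k)) := by
        rw [← inner_sub_right, hs.q_eq]
        congr 1
        abel
      have p3 : inner ℝ (-(lam⁻¹ • (x (k + 1) - x k)) + y (k + 1)
          - V.starProjection (u (k + 1) + gradient H (x k))) z
          = -inner ℝ (lam⁻¹ • (x (k + 1) - x k)) z + (inner ℝ z (y (k + 1))
            - (inner ℝ (V.starProjection z) (u (k + 1))
              + inner ℝ (gradient H (x k)) (V.starProjection z))) := by
        rw [inner_sub_left, V.inner_starProjection_left_eq_right, inner_add_left, inner_add_left,
          inner_neg_left, real_inner_comm z (y (k + 1)), real_inner_comm _ (V.starProjection z)]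
        ring
      rw [inner_sub_right, p1, p3] at e1
      rw [inner_sub_right, p2] at e2
      rw [inner_sub_right] at e3
      rw [real_inner_comm (u (k + 1)) t]
      linarith))
    rw [inner_sub_left, V.inner_starProjection_left_eq_right, inner_add_left,
      real_inner_comm z y₀, real_inner_comm t u₀, real_inner_comm (V.starProjection z) u₀,
      real_inner_comm x₀ g]
    simp only [smul_zero, inner_zero_left, inner_zero_right, sub_zero, add_zero] at this
    linarith
  have hself : inner ℝ (y₀ - V.starProjection (u₀ + g)) x₀ = - inner ℝ u₀ x₀ - inner ℝ g x₀ := by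
    rw [inner_sub_left, V.inner_starProjection_left_eq_right,
      V.starProjection_eq_self_iff.2 hxV, inner_add_left,
      Submodule.inner_left_of_mem_orthogonal hxV hyV]
    ring
  refine ⟨hxV, hyV, ⟨hxC, fun t ht => ?_⟩, fun z => ?_⟩
  · have := key x₀ t ht
    rw [inner_sub_right]
    linarith
  · have := key z x₀ hxC
    rw [← hgrad, inner_sub_right]
    linarith

end IsPrimalDualSequence

end WeakLimits

/-! ### Uniqueness of the weak cluster point. -/

section WeakConvergence

variable {F : Type*} [NormedAddCommGroup F] [InnerProductSpace ℝ F] [CompleteSpace F]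

theorem IsPrimalDualSequence.exists_weak_limit {f H : F → ℝ} {C : Set F} {V : Submodule ℝ F}
    [V.HasOrthogonalProjection] {lam γ β : ℝ} {x y u w q : ℕ → F}
    (hs : IsPrimalDualSequence f H C V lam γ x y u w q)
    (hf : ∀ x, (convexSubdifferential f x).Nonempty)
    (hconv : ConvexOn ℝ Set.univ H) (hdiff : Differentiable ℝ H)
    (hCcl : IsClosed C) (hCco : Convex ℝ C) (hβ : 0 < β)
    (hlip : LipschitzWith (Real.toNNReal β⁻¹) (gradient H))
    (hlam : 0 < lam) (hγ : 0 < γ) (hγlam : γ < 1 / lam - 1 / (2 * β))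
    (hex : ∃ xs ys us, IsPrimalDualSolution f H C V xs ys us) :
    ∃ x₀ y₀ u₀, IsPrimalDualSolution f H C V x₀ y₀ u₀ ∧
      ∀ v, Tendsto (fun k => inner ℝ v (x k)) atTop (𝓝 (inner ℝ v x₀)) := by
  obtain ⟨c, κ, δ, hδ⟩ := exists_isDecreaseRate hβ hlam hγ hγlam
  have hco := gradient_cocoercive hconv hdiff hβ hlip
  obtain ⟨xs, ys, us, hsol⟩ := hex
  obtain ⟨hx0, hy0, hu0, hg⟩ := hs.tendsto_residuals hsol hδ hco
  obtain ⟨R, hR⟩ := hs.exists_bound hsol hδ hco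
  have hlimit : ∀ U : Ultrafilter ℕ, (U : Filter ℕ) ≤ atTop → ∃ x₁ y₁ u₁,
      IsPrimalDualSolution f H C V x₁ y₁ u₁ ∧
      (∀ v, Tendsto (fun k => inner ℝ v (x k)) U (𝓝 (inner ℝ v x₁))) ∧
      (∀ v, Tendsto (fun k => inner ℝ v (y k)) U (𝓝 (inner ℝ v y₁))) ∧
      ∀ v, Tendsto (fun k => inner ℝ v (u k)) U (𝓝 (inner ℝ v u₁)) := by
    intro U hU
    obtain ⟨x₁, hx⟩ := U.exists_tendsto_inner fun k => (hR k).1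
    obtain ⟨y₁, hy⟩ := U.exists_tendsto_inner fun k => (hR k).2.1
    obtain ⟨u₁, hu⟩ := U.exists_tendsto_inner fun k => (hR k).2.2
    exact ⟨x₁, y₁, u₁, hs.isPrimalDualSolution_of_tendsto hf hconv hdiff hCcl hCco hx0 hy0 hu0 hg
      hR hU hx hy hu, hx, hy, hu⟩
  obtain ⟨x₀, y₀, u₀, hsol₀, hx₀, hy₀, hu₀⟩ := hlimit (Ultrafilter.of atTop) (Ultrafilter.of_le _)
  refine ⟨x₀, y₀, u₀, hsol₀, fun v => (tendsto_iff_ultrafilter _ _ _).2 fun U hU => ?_⟩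
  obtain ⟨x₁, y₁, u₁, hsol₁, hx₁, hy₁, hu₁⟩ := hlimit U hU
  suffices h : x₁ = x₀ by
    rw [← h]
    exact hx₁ v
  obtain ⟨L₀, hL₀⟩ := hs.exists_tendsto_energy hsol₀ hδ hco
  obtain ⟨L₁, hL₁⟩ := hs.exists_tendsto_energy hsol₁ hδ hco
  have hS : Tendsto (fun k => inner ℝ (u₁ - u₀) (x k - x (k - 1))) atTop (𝓝 0) := by
    have := Tendsto.inner (𝕜 := ℝ) (tendsto_const_nhds (x := u₁ - u₀))
      ((tendsto_add_atTop_iff_nat (f := fun k => x k - x (k - 1)) 1).1 hx0)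
    rwa [inner_zero_right] at this
  have hsq : ∀ a b z : F, ‖z - a‖ ^ 2 - ‖z - b‖ ^ 2
      = 2 * inner ℝ (b - a) z + (‖a‖ ^ 2 - ‖b‖ ^ 2) := by
    intro a b z
    rw [norm_sub_sq_real, norm_sub_sq_real, inner_sub_left, real_inner_comm a z,
      real_inner_comm b z]
    ring
  -- In the difference of the energies relative to the two solutions, the quadratic terms cancel and
  -- the coupling reduces to `hS`. What remains is an affine functional of the iterates, convergent
  -- along the full sequence. Its limits along both ultrafilters therefore agree, so a weighted
  -- squared distance of the two solutions is zero.
  obtain ⟨L, hL⟩ : ∃ L, Tendsto (fun k => lam⁻¹ * inner ℝ (x₁ - x₀) (x k)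
      + lam * inner ℝ (y₁ - y₀) (y k) + γ⁻¹ * inner ℝ (u₁ - u₀) (u k)) atTop (𝓝 L) := by
    refine ⟨_, (((hL₀.sub hL₁).sub hS).sub_const (lam⁻¹ / 2 * (‖x₀‖ ^ 2 - ‖x₁‖ ^ 2)
      + lam / 2 * (‖y₀‖ ^ 2 - ‖y₁‖ ^ 2) + γ⁻¹ / 2 * (‖u₀‖ ^ 2 - ‖u₁‖ ^ 2))).congr fun k => ?_⟩
    have i1 : 1 / (2 * lam) = lam⁻¹ / 2 := by ring
    have i2 : 1 / (2 * γ) = γ⁻¹ / 2 := by ring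
    have h1 := congrArg (fun s => lam⁻¹ / 2 * s) (hsq x₀ x₁ (x k))
    have h2 := congrArg (fun s => lam / 2 * s) (hsq y₀ y₁ (y k))
    have h3 := congrArg (fun s => γ⁻¹ / 2 * s) (hsq u₀ u₁ (u k))
    simp only [mul_sub, mul_add] at h1 h2 h3
    unfold primalDualEnergy
    rw [i1, i2, inner_sub_left (u k), inner_sub_left (u k), inner_sub_left u₁ u₀ (x k - x (k - 1))]
    linarith
  have e₀ := tendsto_nhds_unique ((((hx₀ (x₁ - x₀)).const_mul lam⁻¹).add
    ((hy₀ (y₁ - y₀)).const_mul lam)).add ((hu₀ (u₁ - u₀)).const_mul γ⁻¹))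
    (hL.mono_left (Ultrafilter.of_le _))
  have e₁ := tendsto_nhds_unique ((((hx₁ (x₁ - x₀)).const_mul lam⁻¹).add
    ((hy₁ (y₁ - y₀)).const_mul lam)).add ((hu₁ (u₁ - u₀)).const_mul γ⁻¹)) (hL.mono_left hU)
  have e : lam⁻¹ * ‖x₁ - x₀‖ ^ 2 + lam * ‖y₁ - y₀‖ ^ 2 + γ⁻¹ * ‖u₁ - u₀‖ ^ 2 = 0 := by
    rw [← real_inner_self_eq_norm_sq, ← real_inner_self_eq_norm_sq, ← real_inner_self_eq_norm_sq,
      inner_sub_right, inner_sub_right (y₁ - y₀), inner_sub_right (u₁ - u₀)]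
    linarith
  have hn1 : 0 ≤ lam * ‖y₁ - y₀‖ ^ 2 := by positivity
  have hn2 : 0 ≤ γ⁻¹ * ‖u₁ - u₀‖ ^ 2 := by positivity
  have hn3 : 0 ≤ lam⁻¹ * ‖x₁ - x₀‖ ^ 2 := by positivity
  have hz : lam⁻¹ * ‖x₁ - x₀‖ ^ 2 = 0 := by linarith
  have hz2 : ‖x₁ - x₀‖ ^ 2 = 0 := (mul_eq_zero.1 hz).resolve_left (inv_ne_zero hlam.ne')
  exact sub_eq_zero.1 (norm_eq_zero.1 (pow_eq_zero_iff two_ne_zero |>.1 hz2))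

end WeakConvergence

/-! ### The maximum of squared distances, its proximal step, and the reduction of the algorithm. -/

section MaxSqDist

variable {N : ℕ} {E : Type*} [NormedAddCommGroup E]

theorem isClosed_prodSet {Q : Fin N → Set E} (hQ : ∀ i, IsClosed (Q i)) :
    IsClosed (prodSet Q) := by
  have : prodSet Q = ⋂ i, {x : HilbertPow N E | x i ∈ Q i} := by
    ext x
    simp [prodSet]
  rw [this]
  exact isClosed_iInter fun i => (hQ i).preimage (PiLp.continuous_apply 2 _ i)

theorem sq_dist_le_maxSqDist (ξ : Fin N → E) (x : HilbertPow N E) (i : Fin N) :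
    ‖x i - ξ i‖ ^ 2 ≤ maxSqDist ξ x :=
  le_ciSup (f := fun i => ‖x i - ξ i‖ ^ 2) (Set.finite_range _).bddAbove i

variable [InnerProductSpace ℝ E]

/-- The `p`-average of the squared distances is a convex minorant of `maxSqDist ξ` that touches it
at `x`, so its gradient there is a subgradient. -/
theorem mem_convexSubdifferential_maxSqDist {ξ : Fin N → E} {x g : HilbertPow N E} {p : Fin N → ℝ}
    (hp : p ∈ stdSimplex ℝ (Fin N)) (hx : maxSqDist ξ x ≤ ∑ i, p i * ‖x i - ξ i‖ ^ 2)
    (hg : ∀ i, g i = (2 * p i) • (x i - ξ i)) : g ∈ convexSubdifferential (maxSqDist ξ) x := by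
  intro z
  have h1 : ∑ i, p i * ‖z i - ξ i‖ ^ 2 ≤ maxSqDist ξ z := by
    calc ∑ i, p i * ‖z i - ξ i‖ ^ 2 ≤ ∑ i, p i * maxSqDist ξ z :=
          Finset.sum_le_sum fun i _ =>
            mul_le_mul_of_nonneg_left (sq_dist_le_maxSqDist ξ z i) (hp.1 i)
      _ = maxSqDist ξ z := by rw [← Finset.sum_mul, hp.2, one_mul]
  refine le_trans (add_le_add_left hx _) (le_trans ?_ h1)
  rw [PiLp.inner_apply, ← Finset.sum_add_distrib]
  refine Finset.sum_le_sum fun i _ => ?_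
  have e : z i - ξ i = (x i - ξ i) + (z i - x i) := by abel
  rw [hg, e, norm_add_sq_real, inner_smul_left, PiLp.sub_apply]
  simp only [RCLike.conj_to_real]
  nlinarith only [mul_nonneg (hp.1 i) (sq_nonneg ‖z i - x i‖)]

theorem convexSubdifferential_maxSqDist_nonempty (hN : 1 ≤ N) (ξ : Fin N → E)
    (x : HilbertPow N E) : (convexSubdifferential (maxSqDist ξ) x).Nonempty := by
  have : Nonempty (Fin N) := ⟨⟨0, hN⟩⟩
  obtain ⟨i, hi⟩ := exists_eq_ciSup_of_finite (f := fun i => ‖x i - ξ i‖ ^ 2)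
  refine ⟨WithLp.toLp 2 fun j => (2 * (Pi.single i 1 : Fin N → ℝ) j) • (x j - ξ j),
    mem_convexSubdifferential_maxSqDist (p := Pi.single i 1) (single_mem_stdSimplex ℝ i) ?_
      fun j => rfl⟩
  rw [Finset.sum_eq_single i (fun j _ hj => by rw [Pi.single_eq_of_ne hj, zero_mul])
    (fun h => absurd (Finset.mem_univ i) h), Pi.single_eq_same, one_mul]
  exact hi.ge

theorem hasDerivAt_div_one_add_line {lam a : ℝ} (h : 1 + 2 * lam * a ≠ 0) (b : ℝ) :
    HasDerivAt (fun t : ℝ => (a + t * (b - a)) / (1 + 2 * lam * (a + t * (b - a))))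
      ((b - a) / (1 + 2 * lam * a) ^ 2) 0 := by
  have h1 : HasDerivAt (fun t : ℝ => a + t * (b - a)) (b - a) 0 := by
    simpa using ((hasDerivAt_id (0 : ℝ)).mul_const (b - a)).const_add a
  have h2 := h1.div ((h1.const_mul (2 * lam)).const_add 1) (by simpa using h)
  refine h2.congr_deriv ?_
  simp only [zero_mul, add_zero]
  congr 1
  ring

theorem le_sum_of_mem_simplexArgmax {α : Fin N → ℝ} {lam : ℝ} (hlam : 0 < lam) {p : Fin N → ℝ}
    (hp : p ∈ simplexArgmax α lam) (j : Fin N) :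
    α j / (1 + 2 * lam * p j) ^ 2 ≤ ∑ i, p i * (α i / (1 + 2 * lam * p i) ^ 2) := by
  obtain ⟨hps, hmax⟩ := hp
  have hpos : ∀ i, 0 < 1 + 2 * lam * p i := fun i => by
    have := mul_nonneg hlam.le (hps.1 i)
    linarith
  -- First-order optimality of `p` in the direction of the vertex `q` of the simplex.
  obtain ⟨q, hq⟩ : ∃ q : Fin N → ℝ, q = Pi.single j 1 := ⟨_, rfl⟩
  have hqs : q ∈ stdSimplex ℝ (Fin N) := hq ▸ single_mem_stdSimplex ℝ j
  have hd : HasDerivAt (fun t : ℝ => ∑ i, (p i + t * (q i - p i))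
      / (1 + 2 * lam * (p i + t * (q i - p i))) * α i)
      (∑ i, (q i - p i) / (1 + 2 * lam * p i) ^ 2 * α i) 0 :=
    HasDerivAt.fun_sum fun i _ => (hasDerivAt_div_one_add_line (hpos i).ne' (q i)).mul_const (α i)
  have h := nonpos_of_hasDerivAt_of_le hd fun t ht0 ht1 => by
    have hmem := convex_stdSimplex ℝ (Fin N) hps hqs (sub_nonneg.2 ht1) ht0.le (by ring)
    have e : (1 - t) • p + t • q = fun i => p i + t * (q i - p i) := by
      funext i
      simp only [Pi.add_apply, Pi.smul_apply, smul_eq_mul]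
      ring
    rw [e] at hmem
    have := hmax hmem
    simpa using this
  have e : ∑ i, (q i - p i) / (1 + 2 * lam * p i) ^ 2 * α i
      = ∑ i, q i * (α i / (1 + 2 * lam * p i) ^ 2)
        - ∑ i, p i * (α i / (1 + 2 * lam * p i) ^ 2) := by
    rw [← Finset.sum_sub_distrib]
    exact Finset.sum_congr rfl fun i _ => by ring
  have e2 : ∑ i, q i * (α i / (1 + 2 * lam * p i) ^ 2) = α j / (1 + 2 * lam * p j) ^ 2 := by
    rw [Finset.sum_eq_single j (fun i _ hi => by rw [hq, Pi.single_eq_of_ne hi, zero_mul])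
      (fun h => absurd (Finset.mem_univ j) h), hq, Pi.single_eq_same, one_mul]
  rw [e, e2] at h
  linarith

/-- The step through `simplexArgmax` computes the proximal point of `lam • maxSqDist ξ` at `z`. -/
theorem smul_sub_mem_convexSubdifferential_maxSqDist (hN : 1 ≤ N) {ξ : Fin N → E}
    {z w : HilbertPow N E} {lam : ℝ} (hlam : 0 < lam) {p : Fin N → ℝ}
    (hp : p ∈ simplexArgmax (fun i => ‖z i - ξ i‖ ^ 2) lam)
    (hw : ∀ i, w i = (1 / (1 + 2 * lam * p i)) • (z i + (2 * lam * p i) • ξ i)) :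
    lam⁻¹ • (z - w) ∈ convexSubdifferential (maxSqDist ξ) w := by
  have : Nonempty (Fin N) := ⟨⟨0, hN⟩⟩
  have hpos : ∀ i, 0 < 1 + 2 * lam * p i := fun i => by
    have := mul_nonneg hlam.le (hp.1.1 i)
    linarith
  have hwi : ∀ i, z i - ξ i = (1 + 2 * lam * p i) • (w i - ξ i) := by
    intro i
    rw [hw, smul_sub, smul_smul, mul_one_div_cancel (hpos i).ne', one_smul]
    module
  have hni : ∀ i, ‖z i - ξ i‖ ^ 2 / (1 + 2 * lam * p i) ^ 2 = ‖w i - ξ i‖ ^ 2 := by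
    intro i
    rw [hwi, norm_smul, Real.norm_of_nonneg (hpos i).le, mul_pow,
      mul_div_cancel_left₀ _ (pow_ne_zero 2 (hpos i).ne')]
  -- By `hni`, the stationarity condition says that no `‖w j - ξ j‖ ^ 2` exceeds the `p`-average.
  refine mem_convexSubdifferential_maxSqDist hp.1 (ciSup_le fun j => ?_) fun i => ?_
  · have := le_sum_of_mem_simplexArgmax hlam hp j
    simpa only [hni] using this
  · have e : z i - w i = (2 * lam * p i) • (w i - ξ i) := by
      have e1 : z i - w i = (z i - ξ i) - (w i - ξ i) := by abel
      rw [e1, hwi]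
      module
    rw [PiLp.smul_apply, PiLp.sub_apply, e, smul_smul]
    congr 1
    field_simp

theorem convex_prodSet {Q : Fin N → Set E} (hQ : ∀ i, Convex ℝ (Q i)) : Convex ℝ (prodSet Q) :=
  fun _ hx _ hy _ _ ha hb hab i => hQ i (hx i) (hy i) ha hb hab

theorem mem_convexNormalCone_prodSet {Q : Fin N → Set E} {x v : HilbertPow N E}
    (h : ∀ i, v i ∈ convexNormalCone (Q i) (x i)) : v ∈ convexNormalCone (prodSet Q) x := by
  refine ⟨fun i => (h i).1, fun y hy => ?_⟩
  rw [PiLp.inner_apply]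
  exact Finset.sum_nonpos fun i _ => (h i).2 (y i) (hy i)

variable [CompleteSpace E]

/-- Take for `y` the `Vᗮ`-component of `g`. Since `v ∈ Vᗮ`, projecting the inclusion onto `V` shows
that the expression in `sub_mem` is `g` itself. -/
theorem OptimalityInclusion.exists_isPrimalDualSolution {H : HilbertPow N E → ℝ}
    {V : Submodule ℝ (HilbertPow N E)} [V.HasOrthogonalProjection] {Q : Fin N → Set E}
    {ξ : Fin N → E} {x : HilbertPow N E} (h : OptimalityInclusion H V Q ξ x) :
    ∃ y u, IsPrimalDualSolution (maxSqDist ξ) H (prodSet Q) V x y u := by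
  obtain ⟨g, hg, u, hu, v, ⟨hxV, hv⟩, hsum⟩ := h
  have hvo : v ∈ Vᗮ := by
    refine (Submodule.mem_orthogonal' V v).2 fun z hz => le_antisymm ?_ ?_
    · simpa using hv (x + z) (V.add_mem hxV hz)
    · simpa using hv (x - z) (V.sub_mem hxV hz)
  refine ⟨g - V.starProjection g, u, hxV, V.sub_starProjection_mem_orthogonal g, hu, ?_⟩
  have e : g + (u + gradient H x) = -v := by
    rw [← add_assoc]
    exact eq_neg_of_add_eq_zero_left hsum
  rwa [sub_sub, ← map_add, e, map_neg, (V.starProjection_apply_eq_zero_iff).2 hvo, neg_zero,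
    sub_zero]

theorem IsPrimalDualSolution.isQuadMaxSolution {H : HilbertPow N E → ℝ}
    {V : Submodule ℝ (HilbertPow N E)} [V.HasOrthogonalProjection] {Q : Fin N → Set E}
    {ξ : Fin N → E} {x y u : HilbertPow N E} (hconv : ConvexOn ℝ Set.univ H)
    (hdiff : Differentiable ℝ H)
    (h : IsPrimalDualSolution (maxSqDist ξ) H (prodSet Q) V x y u) :
    IsQuadMaxSolution H V Q ξ x := by
  refine ⟨⟨h.x_mem, h.u_mem.1⟩, fun z hz => ?_⟩
  have hzx := V.sub_mem hz.1 h.x_mem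
  have h1 := h.sub_mem z
  have h2 := h.u_mem.2 z hz.2
  have h3 := add_inner_gradient_le hconv hdiff x z
  rw [inner_sub_left, V.inner_starProjection_left_eq_right, V.starProjection_eq_self_iff.2 hzx,
    Submodule.inner_left_of_mem_orthogonal hzx h.y_mem, inner_add_left] at h1
  change H x + maxSqDist ξ x ≤ H z + maxSqDist ξ z
  linarith

theorem IsPrimalDualRoutine.isPrimalDualSequence (hN : 1 ≤ N) {H : HilbertPow N E → ℝ}
    {V : Submodule ℝ (HilbertPow N E)} [V.HasOrthogonalProjection]
    (hV : IsClosed (V : Set (HilbertPow N E))) {Q : Fin N → Set E} (hQne : ∀ i, (Q i).Nonempty)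
    (hQcl : ∀ i, IsClosed (Q i)) (hQconv : ∀ i, Convex ℝ (Q i)) {ξ : Fin N → E} {lam γ : ℝ}
    (hlam : 0 < lam) (hγ : 0 < γ) {u x xbar y zbar w : ℕ → HilbertPow N E} {p : ℕ → Fin N → ℝ}
    (hx0 : x 0 ∈ V) (hxbar0 : xbar 0 = x 0) (hy0 : y 0 ∈ Vᗮ)
    (h : IsPrimalDualRoutine H V Q ξ lam γ u x xbar y zbar w p) :
    IsPrimalDualSequence (maxSqDist ξ) H (prodSet Q) V lam γ x y u (fun k => w (k + 1))
      (fun k => WithLp.toLp 2 fun i => metricProj (Q i) (γ⁻¹ • u k i + xbar k i)) := by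
  have hxw : ∀ k, x (k + 1) = V.starProjection (w (k + 1)) := fun k => by
    rw [h.x_step, metricProj_submodule V hV]
  have hyw : ∀ k, lam • (y (k + 1) - y k) = x (k + 1) - w (k + 1) := fun k => by
    rw [h.y_step, add_sub_cancel_left, smul_smul, mul_inv_cancel₀ hlam.ne', one_smul]
  -- At `k = 0`, truncated subtraction makes the extrapolation term vanish, which matches `xbar 0 =
  -- x 0`.
  have hxbar : ∀ k, xbar k = x k + (x k - x (k - 1)) := by
    intro k
    cases k with
    | zero => rw [hxbar0, Nat.zero_sub, sub_self, add_zero]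
    | succ k =>
      rw [h.xbar_step, Nat.add_sub_cancel, two_smul]
      abel
  have hu : ∀ k i, u (k + 1) i = γ • (γ⁻¹ • u k i + xbar k i
      - metricProj (Q i) (γ⁻¹ • u k i + xbar k i)) := fun k i => by
    rw [h.u_step, smul_sub, smul_add, smul_smul, mul_inv_cancel₀ hγ.ne', one_smul]
  refine ⟨fun k => ?_, fun k => ?_, fun k => ?_, fun k => ?_, fun k => ?_, fun k => ?_⟩
  · cases k with
    | zero => exact hx0
    | succ k =>
      rw [hxw]
      exact V.starProjection_apply_mem _
  · induction k with
    | zero => exact hy0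
    | succ k ih =>
      rw [h.y_step, hxw, ← neg_sub (w (k + 1))]
      exact Vᗮ.add_mem ih (Vᗮ.smul_mem _ (Vᗮ.neg_mem (V.sub_starProjection_mem_orthogonal _)))
  · rw [hyw, sub_sub_cancel]
  · rw [← hxbar]
    ext i
    rw [PiLp.sub_apply, PiLp.smul_apply, PiLp.sub_apply, hu, smul_sub, smul_smul,
      inv_mul_cancel₀ hγ.ne', one_smul]
    change metricProj (Q i) (γ⁻¹ • u k i + xbar k i) = _
    abel
  · refine mem_convexNormalCone_prodSet fun i => ⟨(metricProj_spec (hQne i) (hQcl i) (hQconv i)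
      _).1, fun z hz => ?_⟩
    rw [hu, inner_smul_left]
    exact mul_nonpos_of_nonneg_of_nonpos hγ.le
      (inner_sub_metricProj_le (hQne i) (hQcl i) (hQconv i) _ hz)
  · have := smul_sub_mem_convexSubdifferential_maxSqDist hN hlam (h.p_step k) (h.w_step k)
    convert this using 1
    have hw : w (k + 1) = x (k + 1) - lam • (y (k + 1) - y k) := by rw [hyw, sub_sub_cancel]
    rw [hw, h.z_step, metricProj_submodule V hV]
    have e : ∀ a : HilbertPow N E, lam⁻¹ • lam • a = a := fun a => by
      rw [smul_smul, inv_mul_cancel₀ hlam.ne', one_smul]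
    simp only [smul_sub, smul_add, e]
    abel

end MaxSqDist

theorem mainTheorem5 {E : Type*} [NormedAddCommGroup E] [InnerProductSpace ℝ E] [CompleteSpace E]
    (N : ℕ) (hN : 1 ≤ N)
    (H : HilbertPow N E → ℝ) (hHconv : ConvexOn ℝ Set.univ H) (hHdiff : Differentiable ℝ H)
    (β : ℝ) (hβ : 0 < β) (hHlip : LipschitzWith (Real.toNNReal β⁻¹) (gradient H))
    (Q : Fin N → Set E) (hQne : ∀ i, (Q i).Nonempty) (hQcl : ∀ i, IsClosed (Q i))
    (hQconv : ∀ i, Convex ℝ (Q i))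
    (V : Submodule ℝ (HilbertPow N E)) (hV : IsClosed (V : Set (HilbertPow N E)))
    (ξ : Fin N → E)
    (hopt : ∃ x, OptimalityInclusion H V Q ξ x)
    (lam : ℝ) (hlam : lam ∈ Set.Ioo 0 (2 * β))
    (γ : ℝ) (hγ : 0 < γ) (hγlam : γ < 1 / lam - 1 / (2 * β))
    (u x xbar y zbar w : ℕ → HilbertPow N E) (p : ℕ → Fin N → ℝ)
    (hx0 : x 0 ∈ V) (hxbar0 : xbar 0 = x 0) (hy0 : y 0 ∈ Vᗮ)
    (hrun : IsPrimalDualRoutine H V Q ξ lam γ u x xbar y zbar w p) :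
    ∃ xsol : HilbertPow N E, IsQuadMaxSolution H V Q ξ xsol ∧ TendstoWeakly x xsol := by
  have : CompleteSpace V := hV.completeSpace_coe
  have hs := hrun.isPrimalDualSequence hN hV hQne hQcl hQconv hlam.1 hγ hx0 hxbar0 hy0
  obtain ⟨xs, hxs⟩ := hopt
  obtain ⟨xsol, ysol, usol, hsol, hlim⟩ := hs.exists_weak_limit
    (convexSubdifferential_maxSqDist_nonempty hN ξ) hHconv hHdiff (isClosed_prodSet hQcl)
    (convex_prodSet hQconv) hβ hHlip hlam.1 hγ hγlam ⟨xs, hxs.exists_isPrimalDualSolution⟩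
  exact ⟨xsol, hsol.isQuadMaxSolution hHconv hHdiff, tendstoWeakly_of_tendsto_inner hlim⟩
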